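/- Let $d\ge 0$ and let $a_1,\dots,a_d\in\mathbb{C}$ satisfy $\sum_{i=1}^d|a_i|\le 1$. Then the polynomial $p(z_1,\dots,z_d)=1-\sum_{i=1}^d a_iz_i$ is an Agler denominator. Here, for $p\in\mathbb{C}[z_1,\dots,z_d]$, let $\deg p=(\deg_1p,\dots,\deg_dp)$, where $\deg_i p$ is the degree of $p$ in $z_i$, let $\bar p(z)=\overline{p(\bar z)}$, and let $1/z=(1/z_1,\dots,1/z_d)$, so that $z^{\deg p}\,\bar p(1/z)$ is a polynomial. The polynomial $p$ is an *Agler denominator* if it has no zeros in the open polydisk $\mathbb{D}^d$ and the rational function $$f(z)=\frac{z^{\deg p}\,\bar p(1/z)}{p(z)}$$ belongs to the Schur–Agler class, that is, $f$ is analytic on $\mathbb{D}^d$ and, if $f(z)=\sum_{r\in\mathbb{N}_0^d}c_rz^r$ is its power series on $\mathbb{D}^d$, the series $f(T)=\sum_r c_rT_1^{r_1}\cdots T_d^{r_d}$ converges in operator norm and satisfies $\|f(T)\|\le 1$ for every $d$-tuple $T=(T_1,\dots,T_d)$ of pairwise commuting operators with $\|T_i\|<1$ on a common complex Hilbert space.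 -/

import Mathlib

open scoped ComplexConjugate

universe u

noncomputable section

namespace AglerDen

/-- The open unit polydisk `𝔻^d` in `ℂ^d`. -/
def polydisk (d : ℕ) : Set (Fin d → ℂ) := {z | ∀ i, ‖z i‖ < 1}

/-- A `d`-variable polynomial is semi-stable if it has no zeros in the open polydisk. -/
def IsSemiStable {d : ℕ} (p : MvPolynomial (Fin d) ℂ) : Prop :=
  ∀ z ∈ polydisk d, MvPolynomial.eval z p ≠ 0

/-- The multi-degree `deg p = (deg_1 p, …, deg_d p)`, where `deg_i p` is the degree of `p` as a
polynomial in `z_i`. -/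
def multiDegree {d : ℕ} (p : MvPolynomial (Fin d) ℂ) : Fin d →₀ ℕ :=
  Finsupp.equivFunOnFinite.symm fun i => p.degreeOf i

/-- The polynomial `z^n p̄(1/z)`, for `n ≥ deg p`, where `p̄(z) = conj (p (conj z))`: if
`p = ∑ p_k z^k`, it is `∑ conj(p_k) z^(n-k)`. -/
def reflection {d : ℕ} (n : Fin d →₀ ℕ) (p : MvPolynomial (Fin d) ℂ) : MvPolynomial (Fin d) ℂ :=
  ∑ k ∈ p.support, MvPolynomial.monomial (n - k) (conj (p.coeff k))

/-- The defining identity of `reflection`, at points with nonzero coordinates. -/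
theorem eval_reflection {d : ℕ} (n : Fin d →₀ ℕ) (p : MvPolynomial (Fin d) ℂ)
    (hn : multiDegree p ≤ n) (z : Fin d → ℂ) (hz : ∀ i, z i ≠ 0) :
    MvPolynomial.eval z (reflection n p) =
      (∏ i, z i ^ n i) * conj (MvPolynomial.eval (fun i => conj (1 / z i)) p) := by
  rw [reflection, map_sum, MvPolynomial.eval_eq', map_sum, Finset.mul_sum]
  refine Finset.sum_congr rfl fun k hk => ?_
  rw [MvPolynomial.eval_monomial, Finsupp.prod_fintype _ _ (by simp), map_mul, map_prod,
    mul_left_comm, ← Finset.prod_mul_distrib]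
  congr 1
  refine Finset.prod_congr rfl fun i _ => ?_
  have h : k i ≤ n i :=
    (MvPolynomial.monomial_le_degreeOf i hk).trans (by simpa [multiDegree] using hn i)
  simp only [map_pow, Complex.conj_conj, Finsupp.coe_tsub, Pi.sub_apply]
  rw [pow_sub₀ _ (hz i) h, one_div, inv_pow]

/-- The monomial `T^r = T_1^{r_1} ⋯ T_d^{r_d}` in a `d`-tuple of operators. -/
def opMonomial {d : ℕ} {H : Type*} [NormedAddCommGroup H] [InnerProductSpace ℂ H]
    (T : Fin d → H →L[ℂ] H) (r : Fin d →₀ ℕ) : H →L[ℂ] H :=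
  (List.ofFn fun i => T i ^ r i).prod

/-- The power series `∑ c_r z^r` converges to `f` on the open polydisk. -/
def HasSeriesOnPolydisk {d : ℕ} (f : (Fin d → ℂ) → ℂ) (c : MvPowerSeries (Fin d) ℂ) : Prop :=
  ∀ z ∈ polydisk d, HasSum (fun r : Fin d →₀ ℕ => MvPowerSeries.coeff r c * ∏ i, z i ^ r i) (f z)

/-- The scalar Schur–Agler class `𝒮𝒜_d`: `f` is analytic on the open polydisk, and, if
`f(z) = ∑ c_r z^r` is its (unique) power series there, then `f(T) = ∑ c_r T^r` converges in
operator norm with `‖f(T)‖ ≤ 1` for every `d`-tuple `T` of commuting strict contractions on a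
common complex Hilbert space. -/
def IsSchurAgler {d : ℕ} (f : (Fin d → ℂ) → ℂ) : Prop :=
  AnalyticOnNhd ℂ f (polydisk d) ∧
  ∃ c : MvPowerSeries (Fin d) ℂ, HasSeriesOnPolydisk f c ∧
    ∀ (H : Type u) [NormedAddCommGroup H] [InnerProductSpace ℂ H] [CompleteSpace H]
      (T : Fin d → H →L[ℂ] H), (∀ i j, Commute (T i) (T j)) → (∀ i, ‖T i‖ < 1) →
      ∃ A : H →L[ℂ] H,
        HasSum (fun r : Fin d →₀ ℕ => MvPowerSeries.coeff r c • opMonomial T r) A ∧ ‖A‖ ≤ 1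

/-- A polynomial `p` is an Agler denominator if it is semi-stable and the rational function
`z^{deg p} p̄(1/z) / p(z)` is in the Schur–Agler class. -/
def IsAglerDenominator {d : ℕ} (p : MvPolynomial (Fin d) ℂ) : Prop :=
  IsSemiStable p ∧
  IsSchurAgler.{u} fun z : Fin d → ℂ =>
    MvPolynomial.eval z (reflection (multiDegree p) p) / MvPolynomial.eval z p

end AglerDen

end

/-!
Write `aᵢ = uᵢ²` and let `K = u uᵀ`, a rank-one matrix of norm at most `∑ |aᵢ|`. With
`Z = diag(z₁, …, z_d)`, both polynomials are determinants:
`p(z) = 1 - ∑ aᵢ zᵢ = det (1 - K Z)` and `∏ zᵢ - ∑ conj(aᵢ) ∏_{j ≠ i} zⱼ = det (Z - K*)`. The second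
one is the reflection of `p`, once the variables with `aᵢ = 0` are replaced by `1`.

Suppose `‖K‖ < 1` and let commuting contractions `Tᵢ` on `H` act as the `zᵢ`. The operator
`(x, y) ↦ (T (x - K* y), S (y - K x))` with `S* S = (1 - K K*)⁻¹`, `T* T = (1 - K* K)⁻¹` preserves
`‖y‖² - ‖x‖²`. Putting `x = Z y` shows that the block operator `T (Z - K*)` on `H ^ n` is dominated
in norm by `S (1 - K Z)`. Domination passes from block operators with commuting entries to their
determinants: exchange one row at a time, summing over all selections of rows. Since
`|det S| = |det T|`, the operator `det (Z - K*)` is dominated by `det (1 - K Z)`, also in the limit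
`∑ |aᵢ| = 1`.

The power series of `1 / p` has coefficients of modulus at most `1`, so it converges absolutely on
strict contractions. Its sum inverts `p(T)`, and the domination becomes `‖f(T)‖ ≤ 1`.
-/

noncomputable section

namespace AglerDen

open scoped ComplexOrder Matrix Matrix.Module MatrixOrder

section DeterminantDomination

theorem sum_sum_update {ι α M : Type*} [Fintype ι] [DecidableEq ι] [Fintype α] [AddCommMonoid M]
    (k : ι) (g : (ι → α) → M) :
    ∑ σ : ι → α, ∑ i, g (Function.update σ k i) = Fintype.card α • ∑ σ, g σ := by
  have hswap : ∑ x : (ι → α) × α, g (Function.update x.1 k x.2) = ∑ x : (ι → α) × α, g x.1 := by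
    refine Finset.sum_nbij' (fun x => (Function.update x.1 k x.2, x.1 k))
      (fun x => (Function.update x.1 k x.2, x.1 k)) ?_ ?_ ?_ ?_ ?_ <;> simp
  rw [Fintype.sum_prod_type, Fintype.sum_prod_type_right] at hswap
  simpa using hswap

/-- The matrix whose `l`-th row is row `σ l` of `M l`. The sum of its squared determinants over all
`σ` interpolates between the determinants of two matrices as the members of the family `M` are
exchanged one at a time. -/
def rowSelection {l m n R : Type*} (M : l → Matrix m n R) (σ : l → m) : Matrix l n R :=
  Matrix.of fun i => M i (σ i)

theorem rowSelection_const {l m n R : Type*} (B : Matrix m n R) (σ : l → m) :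
    rowSelection (fun _ => B) σ = B.submatrix σ id := rfl

theorem rowSelection_update {l m n R : Type*} [DecidableEq l] (M : l → Matrix m n R) (σ : l → m)
    (k : l) (B : Matrix m n R) (i : m) :
    rowSelection (Function.update M k B) (Function.update σ k i) =
      (rowSelection M σ).updateRow k (B i) := by
  ext r j
  rcases eq_or_ne r k with rfl | hr <;> simp [rowSelection, *]

variable {n R H : Type*} [Fintype n] [DecidableEq n] [CommRing R]

theorem det_updateRow_eq_sum (A : Matrix n n R) (k : n) (b : n → R) :
    (A.updateRow k b).det = ∑ j, b j * (A.updateRow k (Pi.single j 1)).det := by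
  rw [Matrix.det_eq_sum_mul_adjugate_row _ k]
  simp only [Matrix.updateRow_self, Matrix.adjugate_apply, Matrix.updateRow_idem]

variable [SeminormedAddCommGroup H] [Module R H]

theorem smul_det_updateRow (A B : Matrix n n R) (k i : n) (h : H) :
    (B • fun j => (A.updateRow k (Pi.single j 1)).det • h) i = (A.updateRow k (B i)).det • h := by
  rw [det_updateRow_eq_sum, Matrix.Module.smul_apply, Finset.sum_smul]
  simp only [mul_smul]

theorem sum_norm_det_rowSelection_update_le {B C : Matrix n n R}
    (hBC : ∀ y : n → H, ‖WithLp.toLp 2 (B • y)‖ ≤ ‖WithLp.toLp 2 (C • y)‖)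
    (M : n → Matrix n n R) (k : n) (h : H) :
    ∑ σ, ‖(rowSelection (Function.update M k B) σ).det • h‖ ^ 2 ≤
      ∑ σ, ‖(rowSelection (Function.update M k C) σ).det • h‖ ^ 2 := by
  have : Nonempty n := ⟨k⟩
  refine le_of_nsmul_le_nsmul_right (Fintype.card_ne_zero (α := n)) ?_
  rw [← sum_sum_update k, ← sum_sum_update k]
  refine Finset.sum_le_sum fun σ _ => ?_
  have hrow := pow_le_pow_left₀ (norm_nonneg _)
    (hBC fun j => ((rowSelection M σ).updateRow k (Pi.single j 1)).det • h) 2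
  simpa only [PiLp.norm_sq_eq_of_L2, smul_det_updateRow, rowSelection_update] using hrow

theorem sum_norm_det_submatrix_le {B C : Matrix n n R}
    (hBC : ∀ y : n → H, ‖WithLp.toLp 2 (B • y)‖ ≤ ‖WithLp.toLp 2 (C • y)‖) (h : H) :
    ∑ σ : n → n, ‖(B.submatrix σ id).det • h‖ ^ 2 ≤
      ∑ σ : n → n, ‖(C.submatrix σ id).det • h‖ ^ 2 := by
  have hexchange : ∀ s : Finset n, ∑ σ, ‖(rowSelection (fun _ => B) σ).det • h‖ ^ 2 ≤
      ∑ σ, ‖(rowSelection (s.piecewise (fun _ => C) fun _ => B) σ).det • h‖ ^ 2 := by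
    intro s
    induction s using Finset.induction_on with
    | empty => simp
    | insert k s hk ih =>
      have hstep := sum_norm_det_rowSelection_update_le hBC
        (s.piecewise (fun _ => C) fun _ => B) k h
      rw [← Finset.piecewise_insert s (fun _ => C) (fun _ => B) k,
        Function.update_eq_self_iff.2 (Finset.piecewise_eq_of_notMem s _ _ hk).symm] at hstep
      exact ih.trans hstep
  simpa [rowSelection_const] using hexchange Finset.univ

theorem sum_norm_det_submatrix (B : Matrix n n R) (h : H) :
    ∑ σ : n → n, ‖(B.submatrix σ id).det • h‖ ^ 2 =
      Fintype.card (Equiv.Perm n) * ‖B.det • h‖ ^ 2 := by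
  have hperm (π : Equiv.Perm n) :
      ‖B.det • h‖ ^ 2 = ‖(B.submatrix π id).det • h‖ ^ 2 := by
    rw [Matrix.det_permute]
    rcases Int.units_eq_one_or (Equiv.Perm.sign π) with hπ | hπ <;> simp [hπ]
  have hnonperm (σ : n → n) (hσ : σ ∉ Set.range fun π : Equiv.Perm n => ⇑π) :
      ‖(B.submatrix σ id).det • h‖ ^ 2 = 0 := by
    have hinj : ¬ Function.Injective σ := fun hinj =>
      hσ ⟨Equiv.ofBijective σ (Finite.injective_iff_bijective.1 hinj), rfl⟩
    obtain ⟨i, j, hij, hne⟩ := Function.not_injective_iff.1 hinj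
    rw [Matrix.det_zero_of_row_eq hne (by ext l; simp [hij])]
    simp
  rw [← Fintype.sum_of_injective _ Equiv.coe_fn_injective _ _ hnonperm hperm]
  simp

theorem norm_det_smul_le {B C : Matrix n n R}
    (hBC : ∀ y : n → H, ‖WithLp.toLp 2 (B • y)‖ ≤ ‖WithLp.toLp 2 (C • y)‖) (h : H) :
    ‖B.det • h‖ ≤ ‖C.det • h‖ := by
  have hsum := sum_norm_det_submatrix_le hBC h
  rw [sum_norm_det_submatrix, sum_norm_det_submatrix] at hsum
  have hcard : (0 : ℝ) < Fintype.card (Equiv.Perm n) := by exact_mod_cast Fintype.card_pos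
  exact (sq_le_sq₀ (norm_nonneg _) (norm_nonneg _)).1 (le_of_mul_le_mul_left hsum hcard)

end DeterminantDomination

section RankOneDeterminant

variable {n : Type*} [Fintype n] [DecidableEq n]

theorem det_diagonal_sub_vecMulVec_of_ne_zero {F : Type*} [Field F] {z : n → F} (u v : n → F)
    (hz : ∀ i, z i ≠ 0) :
    (Matrix.diagonal z - Matrix.vecMulVec u v).det =
      ∏ i, z i - ∑ i, u i * v i * ∏ j ∈ Finset.univ.erase i, z j := by
  have hfactor : Matrix.diagonal z - Matrix.vecMulVec u v =
      Matrix.diagonal z * (1 + Matrix.replicateCol Unit (fun i => -u i / z i) *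
        Matrix.replicateRow Unit v) := by
    rw [mul_add, mul_one, ← Matrix.vecMulVec_eq, sub_eq_add_neg]
    congr 1
    ext i j
    have := hz i
    simp only [Matrix.neg_apply, Matrix.diagonal_mul, Matrix.vecMulVec_apply]
    field_simp
  rw [hfactor, Matrix.det_mul, Matrix.det_one_add_replicateCol_mul_replicateRow,
    Matrix.det_diagonal, mul_add, mul_one, dotProduct, Finset.mul_sum, sub_eq_add_neg,
    ← Finset.sum_neg_distrib]
  congr 1
  refine Finset.sum_congr rfl fun i _ => ?_
  have := hz i
  rw [← Finset.mul_prod_erase _ z (Finset.mem_univ i)]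
  field_simp

theorem map_det_diagonal_sub_vecMulVec {R S : Type*} [CommRing R] [CommRing S] (f : R →+* S)
    (z u v : n → R) :
    f (Matrix.diagonal z - Matrix.vecMulVec u v).det =
      (Matrix.diagonal (fun i => f (z i)) -
        Matrix.vecMulVec (fun i => f (u i)) fun i => f (v i)).det := by
  rw [RingHom.map_det]
  congr 1
  ext i j
  simp [Matrix.vecMulVec_apply, Matrix.diagonal_apply, apply_ite f]

theorem det_diagonal_sub_vecMulVec {R : Type*} [CommRing R] (z u v : n → R) :
    (Matrix.diagonal z - Matrix.vecMulVec u v).det =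
      ∏ i, z i - ∑ i, u i * v i * ∏ j ∈ Finset.univ.erase i, z j := by
  let P := MvPolynomial (n ⊕ n ⊕ n) ℤ
  let Z : n → P := fun i => .X (.inl i)
  let U : n → P := fun i => .X (.inr (.inl i))
  let V : n → P := fun i => .X (.inr (.inr i))
  have hgeneric : (Matrix.diagonal Z - Matrix.vecMulVec U V).det =
      ∏ i, Z i - ∑ i, U i * V i * ∏ j ∈ Finset.univ.erase i, Z j := by
    have hinj := IsFractionRing.injective P (FractionRing P)
    apply hinj
    rw [map_det_diagonal_sub_vecMulVec, det_diagonal_sub_vecMulVec_of_ne_zero _ _ fun i =>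
      (map_ne_zero_iff _ hinj).2 (MvPolynomial.X_ne_zero _)]
    simp only [Z, map_sub, map_sum, map_mul, map_prod]
  have hspecialize := congrArg
    (MvPolynomial.aeval (R := ℤ) (Sum.elim z (Sum.elim u v))).toRingHom hgeneric
  rw [map_det_diagonal_sub_vecMulVec] at hspecialize
  simpa [Z, U, V] using hspecialize

end RankOneDeterminant

section BlockOperator

variable {n R H : Type*} [Fintype n] [DecidableEq n]

theorem map_algebraMap_smul {S : Type*} [CommRing S] [Ring R] [Algebra S R]
    [AddCommGroup H] [Module S H] [Module R H] [IsScalarTower S R H] (A : Matrix n n S)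
    (v : n → H) : A.map (algebraMap S R) • v = A • v := by
  ext i
  simp [algebraMap_smul]

theorem norm_diagonal_smul_le [Ring R] [SeminormedAddCommGroup H] [Module R H] {z : n → R}
    (hz : ∀ i (x : H), ‖z i • x‖ ≤ ‖x‖) (v : n → H) :
    ‖WithLp.toLp 2 (Matrix.diagonal z • v)‖ ≤ ‖WithLp.toLp 2 v‖ := by
  rw [← sq_le_sq₀ (norm_nonneg _) (norm_nonneg _), PiLp.norm_sq_eq_of_L2, PiLp.norm_sq_eq_of_L2]
  gcongr with i
  simpa [Matrix.diagonal_apply] using hz i (v i)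

end BlockOperator

section Contraction

variable {m n 𝕜 : Type*} [Fintype m] [DecidableEq m] [Fintype n] [DecidableEq n] [RCLike 𝕜]

theorem posDef_one_sub_conjTranspose_mul {K : Matrix m n 𝕜} (hK : (1 - K * Kᴴ).PosDef) :
    (1 - Kᴴ * K).PosDef := by
  have hblock : (Matrix.fromBlocks 1 K Kᴴ 1).PosSemidef :=
    have := invertibleOne (α := Matrix n n 𝕜)
    (Matrix.PosDef.fromBlocks₂₂ 1 K Matrix.PosDef.one).2 (by simpa using hK.posSemidef)
  have hsemi : (1 - Kᴴ * K).PosSemidef := by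
    have := invertibleOne (α := Matrix m m 𝕜)
    simpa using (Matrix.PosDef.fromBlocks₁₁ K 1 Matrix.PosDef.one).1 hblock
  rw [hsemi.posDef_iff_det_ne_zero, ← Matrix.det_one_sub_mul_comm]
  exact hK.det_pos.ne'

theorem exists_conjTranspose_mul_self_mul_eq_one {A : Matrix n n 𝕜} (hA : A.PosDef) :
    ∃ S : Matrix n n 𝕜, Sᴴ * S * A = 1 := by
  obtain ⟨S, hS⟩ := CStarAlgebra.nonneg_iff_eq_star_mul_self.1 hA.inv.posSemidef.nonneg
  refine ⟨S, ?_⟩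
  rw [← Matrix.star_eq_conjTranspose, ← hS,
    Matrix.nonsing_inv_mul _ ((Matrix.isUnit_iff_isUnit_det _).1 hA.isUnit)]

theorem norm_det_conjTranspose_mul_self (A : Matrix n n 𝕜) : ‖(Aᴴ * A).det‖ = ‖A.det‖ ^ 2 := by
  rw [Matrix.det_mul, Matrix.det_conjTranspose, norm_mul, norm_star, sq]

theorem norm_det_eq_norm_det {K S T : Matrix n n 𝕜} (hS : Sᴴ * S * (1 - K * Kᴴ) = 1)
    (hT : Tᴴ * T * (1 - Kᴴ * K) = 1) : ‖T.det‖ = ‖S.det‖ := by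
  have hS_det : (Sᴴ * S).det * (1 - K * Kᴴ).det = 1 := by
    rw [← Matrix.det_mul, hS, Matrix.det_one]
  have hT_det : (Tᴴ * T).det * (1 - K * Kᴴ).det = 1 := by
    rw [Matrix.det_one_sub_mul_comm, ← Matrix.det_mul, hT, Matrix.det_one]
  have hsq : ‖(Tᴴ * T).det‖ = ‖(Sᴴ * S).det‖ := congrArg norm
    (mul_right_cancel₀ (right_ne_zero_of_mul_eq_one hS_det) (hT_det.trans hS_det.symm))
  rw [norm_det_conjTranspose_mul_self, norm_det_conjTranspose_mul_self] at hsq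
  exact (sq_eq_sq₀ (norm_nonneg _) (norm_nonneg _)).1 hsq

variable {H : Type*} [NormedAddCommGroup H] [InnerProductSpace 𝕜 H]

theorem inner_toLp_smul_left (A : Matrix n n 𝕜) (v w : n → H) :
    inner 𝕜 (WithLp.toLp 2 (A • v)) (WithLp.toLp 2 w) =
      inner 𝕜 (WithLp.toLp 2 v) (WithLp.toLp 2 (Aᴴ • w)) := by
  simp only [PiLp.inner_apply, Matrix.Module.smul_apply, sum_inner, inner_sum, inner_smul_left,
    inner_smul_right, Matrix.conjTranspose_apply, RCLike.star_def]
  exact Finset.sum_comm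

theorem norm_toLp_smul_sq (A : Matrix n n 𝕜) (v : n → H) :
    (‖WithLp.toLp 2 (A • v)‖ ^ 2 : 𝕜) =
      inner 𝕜 (WithLp.toLp 2 v) (WithLp.toLp 2 ((Aᴴ * A) • v)) := by
  rw [← inner_self_eq_norm_sq_to_K, inner_toLp_smul_left, mul_smul]

theorem mul_eq_mul_of_mul_one_sub_mul_eq_one {A : Type*} [Ring A] {a b p q : A}
    (hp : p * (1 - a * b) = 1) (hq : (1 - b * a) * q = 1) : p * a = a * q :=
  calc p * a = p * a * ((1 - b * a) * q) := by rw [hq, mul_one]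
    _ = p * (1 - a * b) * (a * q) := by noncomm_ring
    _ = a * q := by rw [hp, one_mul]

theorem smul_sub_add_smul_sub {A M : Type*} [Ring A] [AddCommGroup M] [Module A M] {a b p q : A}
    (hp : p * (1 - a * b) = 1) (hq : (1 - b * a) * q = 1) (x y : M) :
    p • (y - a • x) + a • q • (x - b • y) = y :=
  calc p • (y - a • x) + a • q • (x - b • y)
      = p • (y - a • x) + (p * a) • (x - b • y) := by
        rw [mul_eq_mul_of_mul_one_sub_mul_eq_one hp hq, mul_smul]
    _ = (p * (1 - a * b)) • y := by
        simp only [mul_smul, smul_sub, sub_smul, one_smul, sub_add_sub_cancel]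
    _ = y := by rw [hp, one_smul]

-- The operator `(x, y) ↦ (T (x - K* y), S (y - K x))` is the Halmos (or Julia) operator of `K`.
theorem norm_sq_sub_norm_sq_halmos {K S T : Matrix n n 𝕜} (hS : Sᴴ * S * (1 - K * Kᴴ) = 1)
    (hT : Tᴴ * T * (1 - Kᴴ * K) = 1) (x y : n → H) :
    ‖WithLp.toLp 2 (S • (y - K • x))‖ ^ 2 - ‖WithLp.toLp 2 (T • (x - Kᴴ • y))‖ ^ 2 =
      ‖WithLp.toLp 2 y‖ ^ 2 - ‖WithLp.toLp 2 x‖ ^ 2 := by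
  set p := (Sᴴ * S) • (y - K • x) with hp
  set q := (Tᴴ * T) • (x - Kᴴ • y) with hq
  have hy : p + K • q = y := smul_sub_add_smul_sub hS (mul_eq_one_comm.1 hT) x y
  have hx : q + Kᴴ • p = x := smul_sub_add_smul_sub hT (mul_eq_one_comm.1 hS) y x
  have hy_sq : (‖WithLp.toLp 2 y‖ ^ 2 : 𝕜) = inner 𝕜 (WithLp.toLp 2 y) (WithLp.toLp 2 p) +
      inner 𝕜 (WithLp.toLp 2 y) (WithLp.toLp 2 (K • q)) := by
    rw [← inner_add_right, ← WithLp.toLp_add, hy, inner_self_eq_norm_sq_to_K]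
  have hx_sq : (‖WithLp.toLp 2 x‖ ^ 2 : 𝕜) = inner 𝕜 (WithLp.toLp 2 x) (WithLp.toLp 2 q) +
      inner 𝕜 (WithLp.toLp 2 x) (WithLp.toLp 2 (Kᴴ • p)) := by
    rw [← inner_add_right, ← WithLp.toLp_add, hx, inner_self_eq_norm_sq_to_K]
  apply RCLike.ofReal_injective (K := 𝕜)
  push_cast
  rw [norm_toLp_smul_sq, norm_toLp_smul_sq, ← hp, ← hq, hy_sq, hx_sq]
  simp only [WithLp.toLp_sub, inner_sub_left, inner_toLp_smul_left,
    Matrix.conjTranspose_conjTranspose]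
  ring

variable {R : Type*} [CommRing R] [Algebra 𝕜 R] [Module R H] [IsScalarTower 𝕜 R H]

theorem norm_det_diagonal_sub_smul_le {K : Matrix n n 𝕜} (hK : (1 - K * Kᴴ).PosDef) {z : n → R}
    (hz : ∀ i (x : H), ‖z i • x‖ ≤ ‖x‖) (h : H) :
    ‖(Matrix.diagonal z - Kᴴ.map (algebraMap 𝕜 R)).det • h‖ ≤
      ‖(1 - K.map (algebraMap 𝕜 R) * Matrix.diagonal z).det • h‖ := by
  obtain ⟨S, hS⟩ := exists_conjTranspose_mul_self_mul_eq_one hK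
  obtain ⟨T, hT⟩ := exists_conjTranspose_mul_self_mul_eq_one (posDef_one_sub_conjTranspose_mul hK)
  have hdet_pos : 0 < ‖S.det‖ := by
    rw [norm_pos_iff]
    rintro h0
    simpa [h0] using congrArg Matrix.det hS
  have hdom := norm_det_smul_le (H := H)
    (B := T.map (algebraMap 𝕜 R) * (Matrix.diagonal z - Kᴴ.map (algebraMap 𝕜 R)))
    (C := S.map (algebraMap 𝕜 R) * (1 - K.map (algebraMap 𝕜 R) * Matrix.diagonal z)) ?_ h
  · have hdet_map (A : Matrix n n 𝕜) : (A.map (algebraMap 𝕜 R)).det = algebraMap 𝕜 R A.det :=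
      ((algebraMap 𝕜 R).map_det A).symm
    rw [Matrix.det_mul, Matrix.det_mul, mul_smul, mul_smul, hdet_map, hdet_map, algebraMap_smul,
      algebraMap_smul, norm_smul T.det, norm_smul S.det, norm_det_eq_norm_det hS hT] at hdom
    exact le_of_mul_le_mul_left hdom hdet_pos
  · intro y
    have hhalmos := norm_sq_sub_norm_sq_halmos hS hT (Matrix.diagonal z • y) y
    have hz_sq := pow_le_pow_left₀ (norm_nonneg _) (norm_diagonal_smul_le hz y) 2
    rw [← sq_le_sq₀ (norm_nonneg _) (norm_nonneg _)]
    simp only [mul_smul, map_algebraMap_smul, sub_smul, one_smul]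
    linarith

end Contraction

section RankOne

variable {n 𝕜 : Type*} [Fintype n] [DecidableEq n] [RCLike 𝕜]

theorem posDef_one_sub_vecMulVec_self_star {w : n → 𝕜} (hw : ∑ i, ‖w i‖ ^ 2 < 1) :
    (1 - Matrix.vecMulVec w (star w)).PosDef := by
  have hscalar : (1 - (Matrix.replicateCol Unit w)ᴴ * (Matrix.replicateCol Unit w)ᴴᴴ).PosDef := by
    have hentry : (1 - (Matrix.replicateCol Unit w)ᴴ * (Matrix.replicateCol Unit w)ᴴᴴ) =
        Matrix.diagonal fun _ => ((1 - ∑ i, ‖w i‖ ^ 2 : ℝ) : 𝕜) := by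
      ext
      simp [Matrix.mul_apply, RCLike.conj_mul]
    rw [hentry, Matrix.posDef_diagonal_iff]
    intro _
    exact_mod_cast sub_pos.2 hw
  simpa [Matrix.vecMulVec_eq Unit] using posDef_one_sub_conjTranspose_mul hscalar

theorem posDef_one_sub_vecMulVec_mul_conjTranspose {u v : n → 𝕜}
    (huv : (∑ i, ‖u i‖ ^ 2) * ∑ i, ‖v i‖ ^ 2 < 1) :
    (1 - Matrix.vecMulVec u v * (Matrix.vecMulVec u v)ᴴ).PosDef := by
  have hnorm (w : n → 𝕜) : w ⬝ᵥ star w = ((∑ i, ‖w i‖ ^ 2 : ℝ) : 𝕜) := by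
    simp [dotProduct, RCLike.mul_conj]
  obtain ⟨r, hr_sq⟩ : ∃ r : ℝ, r ^ 2 = ∑ i, ‖v i‖ ^ 2 := ⟨_, Real.sq_sqrt (by positivity)⟩
  have hrescale : Matrix.vecMulVec u v * (Matrix.vecMulVec u v)ᴴ =
      Matrix.vecMulVec ((r : 𝕜) • u) (star ((r : 𝕜) • u)) := by
    rw [Matrix.conjTranspose_vecMulVec, Matrix.vecMulVec_mul_vecMulVec, hnorm, ← hr_sq]
    ext i j
    simp only [Matrix.vecMulVec_apply, Pi.smul_apply, Pi.star_apply, smul_eq_mul, star_mul',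
      RCLike.star_def, RCLike.conj_ofReal, RCLike.ofReal_pow]
    ring
  rw [hrescale]
  refine posDef_one_sub_vecMulVec_self_star ?_
  simp only [Pi.smul_apply, norm_smul, RCLike.norm_ofReal, mul_pow, sq_abs]
  rwa [← Finset.mul_sum, hr_sq, mul_comm]

variable {R H : Type*} [CommRing R] [Algebra ℂ R] [NormedAddCommGroup H] [InnerProductSpace ℂ H]
  [Module R H] [IsScalarTower ℂ R H]

theorem norm_prod_sub_sum_smul_le_of_sum_lt_one {a : n → ℂ} (ha : ∑ i, ‖a i‖ < 1) {z : n → R}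
    (hz : ∀ i (x : H), ‖z i • x‖ ≤ ‖x‖) (h : H) :
    ‖(∏ i, z i - ∑ i, algebraMap ℂ R (conj (a i)) * ∏ j ∈ Finset.univ.erase i, z j) • h‖ ≤
      ‖(1 - ∑ i, algebraMap ℂ R (a i) * z i) • h‖ := by
  choose u hu using fun i => IsAlgClosed.exists_pow_nat_eq (a i) two_pos
  have hu_sum : ∑ i, ‖u i‖ ^ 2 < 1 := by simpa only [← norm_pow, hu] using ha
  have hdom := norm_det_diagonal_sub_smul_le (posDef_one_sub_vecMulVec_mul_conjTranspose
    (mul_lt_one_of_nonneg_of_lt_one_left (by positivity) hu_sum hu_sum.le)) hz h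
  have hnum : Matrix.diagonal z - (Matrix.vecMulVec u u)ᴴ.map (algebraMap ℂ R) =
      Matrix.diagonal z - Matrix.vecMulVec (fun i => algebraMap ℂ R (conj (u i)))
        fun i => algebraMap ℂ R (conj (u i)) := by
    ext i j
    simp [Matrix.vecMulVec_apply]
  have hden : 1 - (Matrix.vecMulVec u u).map (algebraMap ℂ R) * Matrix.diagonal z =
      Matrix.diagonal 1 - Matrix.vecMulVec (fun i => algebraMap ℂ R (u i))
        fun i => algebraMap ℂ R (u i) * z i := by
    ext i j
    simp [Matrix.vecMulVec_apply, mul_assoc]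
  rw [hnum, hden, det_diagonal_sub_vecMulVec, det_diagonal_sub_vecMulVec] at hdom
  simpa [← hu, sq, mul_assoc] using hdom

theorem norm_prod_sub_sum_smul_le {a : n → ℂ} (ha : ∑ i, ‖a i‖ ≤ 1) {z : n → R}
    (hz : ∀ i (x : H), ‖z i • x‖ ≤ ‖x‖) (h : H) :
    ‖(∏ i, z i - ∑ i, algebraMap ℂ R (conj (a i)) * ∏ j ∈ Finset.univ.erase i, z j) • h‖ ≤
      ‖(1 - ∑ i, algebraMap ℂ R (a i) * z i) • h‖ := by
  have hscaled (r : ℝ) (hr : r ∈ Set.Ico 0 1) :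
      ‖(∏ i, z i) • h - r • ∑ i, conj (a i) • (∏ j ∈ Finset.univ.erase i, z j) • h‖ ≤
        ‖h - r • ∑ i, a i • z i • h‖ := by
    have hra : ∑ i, ‖(r : ℂ) * a i‖ < 1 := by
      simp only [norm_mul, Complex.norm_real, Real.norm_of_nonneg hr.1, ← Finset.mul_sum]
      exact mul_lt_one_of_nonneg_of_lt_one_left hr.1 hr.2 ha
    simpa [sub_smul, Finset.sum_smul, mul_smul, Finset.smul_sum] using
      norm_prod_sub_sum_smul_le_of_sum_lt_one hra hz h
  have hcont (f g : H) : ContinuousWithinAt (fun r : ℝ => ‖f - r • g‖) (Set.Ico 0 1) 1 := by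
    fun_prop
  have hlimit := (hcont _ _).closure_le (by simp) (hcont _ _) hscaled
  simpa [sub_smul, Finset.sum_smul, mul_smul] using hlimit

end RankOne

section FunctionalCalculus

theorem exists_algHom_X_eq {σ R A : Type*} [CommSemiring R] [Semiring A] [Algebra R A] (T : σ → A)
    (hT : ∀ i j, Commute (T i) (T j)) :
    ∃ φ : MvPolynomial σ R →ₐ[R] A, ∀ i, φ (MvPolynomial.X i) = T i := by
  have hcomm : IsMulCommutative (Algebra.adjoin R (Set.range T)) := by
    refine Algebra.isMulCommutative_adjoin R ?_
    rintro _ ⟨i, rfl⟩ _ ⟨j, rfl⟩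
    exact hT i j
  open scoped IsMulCommutative in
  refine ⟨(Algebra.adjoin R (Set.range T)).val.comp (MvPolynomial.aeval fun i =>
    (⟨T i, Algebra.subset_adjoin ⟨i, rfl⟩⟩ : Algebra.adjoin R (Set.range T))), fun i => ?_⟩
  simp

theorem sum_prod_pow_le {ι : Type*} [Fintype ι] {ρ : ι → ℝ} (hρ₀ : ∀ i, 0 ≤ ρ i)
    (hρ₁ : ∀ i, ρ i < 1) (s : Finset (ι → ℕ)) :
    ∑ r ∈ s, ∏ i, ρ i ^ r i ≤ ∏ i, (1 - ρ i)⁻¹ := by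
  classical
  calc ∑ r ∈ s, ∏ i, ρ i ^ r i
      ≤ ∑ r ∈ Fintype.piFinset fun i => s.image fun r => r i, ∏ i, ρ i ^ r i :=
        Finset.sum_le_sum_of_subset_of_nonneg
          (fun r hr => Fintype.mem_piFinset.2 fun i => Finset.mem_image_of_mem _ hr)
          fun r _ _ => Finset.prod_nonneg fun i _ => pow_nonneg (hρ₀ i) _
    _ = ∏ i, ∑ k ∈ s.image fun r => r i, ρ i ^ k :=
        (Finset.prod_univ_sum _ fun i k => ρ i ^ k).symm
    _ ≤ ∏ i, (1 - ρ i)⁻¹ := by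
        refine Finset.prod_le_prod
          (fun i _ => Finset.sum_nonneg fun k _ => pow_nonneg (hρ₀ i) _) fun i _ => ?_
        rw [← tsum_geometric_of_lt_one (hρ₀ i) (hρ₁ i)]
        exact (summable_geometric_of_lt_one (hρ₀ i) (hρ₁ i)).sum_le_tsum _
          fun k _ => pow_nonneg (hρ₀ i) _

theorem summable_prod_pow {ι : Type*} [Fintype ι] {ρ : ι → ℝ} (hρ₀ : ∀ i, 0 ≤ ρ i)
    (hρ₁ : ∀ i, ρ i < 1) : Summable fun r : ι →₀ ℕ => ∏ i, ρ i ^ r i := by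
  have hfun : Summable fun r : ι → ℕ => ∏ i, ρ i ^ r i :=
    summable_of_sum_le (c := ∏ i, (1 - ρ i)⁻¹)
      (fun r => Finset.prod_nonneg fun i _ => pow_nonneg (hρ₀ i) _)
      (sum_prod_pow_le hρ₀ hρ₁)
  exact Finsupp.equivFunOnFinite.summable_iff (f := fun r : ι → ℕ => ∏ i, ρ i ^ r i) |>.2 hfun

/-- The value `∑ g_r T^r` of a power series `g = ∑ g_r z^r` at the commuting tuple `T_i = φ z_i`
described by a polynomial functional calculus `φ`; as for every `tsum`, it is only meaningful when
the sum converges. -/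
def evalSeries {σ R A : Type*} [CommSemiring R] [Semiring A] [Algebra R A] [TopologicalSpace A]
    (φ : MvPolynomial σ R →ₐ[R] A) (g : MvPowerSeries σ R) : A :=
  ∑' r, MvPowerSeries.coeff r g • φ (MvPolynomial.monomial r 1)

theorem hasSum_coeff_mul_smul {σ R A : Type*} [CommSemiring R] [Semiring A] [Algebra R A]
    [TopologicalSpace A] [IsTopologicalSemiring A] {φ : MvPolynomial σ R →ₐ[R] A}
    {g : MvPowerSeries σ R}
    (hg : Summable fun r => MvPowerSeries.coeff r g • φ (MvPolynomial.monomial r 1))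
    (P : MvPolynomial σ R) :
    HasSum (fun r => MvPowerSeries.coeff r (P * g : MvPowerSeries σ R) •
      φ (MvPolynomial.monomial r 1)) (φ P * evalSeries φ g) := by
  induction P using MvPolynomial.induction_on' with
  | monomial k b =>
    have hterm (r : σ →₀ ℕ) :
        MvPowerSeries.coeff (k + r) (MvPolynomial.monomial k b * g : MvPowerSeries σ R) •
            φ (MvPolynomial.monomial (k + r) 1) =
          φ (MvPolynomial.monomial k b) *
            MvPowerSeries.coeff r g • φ (MvPolynomial.monomial r 1) := by
      rw [MvPolynomial.coe_monomial, MvPowerSeries.coeff_add_monomial_mul, mul_smul_comm,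
        ← map_mul, MvPolynomial.monomial_mul, mul_comm b, mul_smul, ← map_smul φ b,
        MvPolynomial.smul_monomial, smul_eq_mul]
    rw [← (add_right_injective k).hasSum_iff]
    · exact (hg.hasSum.mul_left _).congr_fun hterm
    · intro r hr
      rw [MvPolynomial.coe_monomial, MvPowerSeries.coeff_monomial_mul, if_neg, zero_smul]
      exact fun hkr => hr ⟨r - k, add_tsub_cancel_of_le hkr⟩
  | add P Q hP hQ => simpa only [MvPolynomial.coe_add, add_mul, map_add, add_smul] using hP.add hQ

theorem constantCoeff_coe {σ R : Type*} [CommSemiring R] (p : MvPolynomial σ R) :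
    MvPowerSeries.constantCoeff (p : MvPowerSeries σ R) = p.coeff 0 := by
  rw [← MvPowerSeries.coeff_zero_eq_constantCoeff_apply, MvPolynomial.coeff_coe]

theorem map_mul_evalSeries_inv {σ K A : Type*} [Field K] [Semiring A] [Algebra K A]
    [TopologicalSpace A] [IsTopologicalSemiring A] [T2Space A] {φ : MvPolynomial σ K →ₐ[K] A}
    {p : MvPolynomial σ K} (hp : p.coeff 0 ≠ 0)
    (hs : Summable fun r =>
      MvPowerSeries.coeff r (p : MvPowerSeries σ K)⁻¹ • φ (MvPolynomial.monomial r 1)) :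
    φ p * evalSeries φ (p : MvPowerSeries σ K)⁻¹ = 1 := by
  classical
  have hone : HasSum (fun r => MvPowerSeries.coeff r (1 : MvPowerSeries σ K) •
      φ (MvPolynomial.monomial r 1)) 1 := by
    convert hasSum_single (0 : σ →₀ ℕ) fun r hr => ?_ using 1
    · rw [MvPowerSeries.coeff_zero_one, one_smul, ← MvPolynomial.one_def, map_one]
    · rw [MvPowerSeries.coeff_one, if_neg hr, zero_smul]
  have hprod := hasSum_coeff_mul_smul hs p
  rw [MvPowerSeries.mul_inv_cancel _ (by rwa [constantCoeff_coe])] at hprod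
  exact hprod.unique hone

theorem summable_coeff_smul {σ 𝕜 A : Type*} [Fintype σ] [NormedField 𝕜] [NormedRing A]
    [NormedAlgebra 𝕜 A] [CompleteSpace A] {φ : MvPolynomial σ 𝕜 →ₐ[𝕜] A} {ρ : σ → ℝ}
    (hρ₀ : ∀ i, 0 ≤ ρ i) (hρ₁ : ∀ i, ρ i < 1)
    (hφ : ∀ r, ‖φ (MvPolynomial.monomial r 1)‖ ≤ ∏ i, ρ i ^ r i) {g : MvPowerSeries σ 𝕜} {C : ℝ}
    (hg : ∀ r, ‖MvPowerSeries.coeff r g‖ ≤ C) :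
    Summable fun r => MvPowerSeries.coeff r g • φ (MvPolynomial.monomial r 1) := by
  refine Summable.of_norm_bounded ((summable_prod_pow hρ₀ hρ₁).mul_left C) fun r => ?_
  rw [norm_smul]
  exact mul_le_mul (hg r) (hφ r) (norm_nonneg _) ((norm_nonneg _).trans (hg r))

end FunctionalCalculus

section AglerDenominator

variable {d : ℕ}

theorem monomial_eq_C_mul_prod {σ R : Type*} [Fintype σ] [CommSemiring R] (r : σ →₀ ℕ) (b : R) :
    MvPolynomial.monomial r b = MvPolynomial.C b * ∏ i, MvPolynomial.X i ^ r i := by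
  rw [MvPolynomial.monomial_eq, Finsupp.prod_fintype _ _ (by simp)]

theorem map_monomial_eq_opMonomial {H : Type*} [NormedAddCommGroup H] [InnerProductSpace ℂ H]
    {T : Fin d → H →L[ℂ] H} {φ : MvPolynomial (Fin d) ℂ →ₐ[ℂ] (H →L[ℂ] H)}
    (hφ : ∀ i, φ (MvPolynomial.X i) = T i) (r : Fin d →₀ ℕ) :
    φ (MvPolynomial.monomial r 1) = opMonomial T r := by
  rw [monomial_eq_C_mul_prod, map_one, one_mul, ← List.prod_ofFn, map_list_prod, List.map_ofFn,
    opMonomial]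
  congr 2
  ext1 i
  simp [hφ]

theorem norm_opMonomial_le {H : Type*} [NormedAddCommGroup H] [InnerProductSpace ℂ H]
    (T : Fin d → H →L[ℂ] H) (r : Fin d →₀ ℕ) : ‖opMonomial T r‖ ≤ ∏ i, ‖T i‖ ^ r i := by
  rcases subsingleton_or_nontrivial H with hH | hH
  · rw [Subsingleton.elim (opMonomial T r) 0, norm_zero]
    positivity
  · calc ‖opMonomial T r‖ ≤ ((List.ofFn fun i => T i ^ r i).map norm).prod := List.norm_prod_le _
      _ = ∏ i, ‖T i ^ r i‖ := by rw [List.map_ofFn, List.prod_ofFn]; rfl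
      _ ≤ ∏ i, ‖T i‖ ^ r i :=
        Finset.prod_le_prod (fun i _ => norm_nonneg _) fun i _ => norm_pow_le _ _

/-- The power series of the rational function `z^(deg p) p̄(1/z) / p(z)`, for `p(0) ≠ 0`. -/
def aglerSeries (p : MvPolynomial (Fin d) ℂ) : MvPowerSeries (Fin d) ℂ :=
  (reflection (multiDegree p) p : MvPowerSeries (Fin d) ℂ) * (p : MvPowerSeries (Fin d) ℂ)⁻¹

theorem exists_hasSum_aglerSeries {A : Type*} [NormedRing A] [NormedAlgebra ℂ A] [CompleteSpace A]
    {φ : MvPolynomial (Fin d) ℂ →ₐ[ℂ] A} {ρ : Fin d → ℝ} (hρ₀ : ∀ i, 0 ≤ ρ i) (hρ₁ : ∀ i, ρ i < 1)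
    (hφ : ∀ r, ‖φ (MvPolynomial.monomial r 1)‖ ≤ ∏ i, ρ i ^ r i) {p : MvPolynomial (Fin d) ℂ}
    (hp : p.coeff 0 ≠ 0) {C : ℝ}
    (hC : ∀ r, ‖MvPowerSeries.coeff r (p : MvPowerSeries (Fin d) ℂ)⁻¹‖ ≤ C) :
    ∃ E : A, φ p * E = 1 ∧
      HasSum (fun r => MvPowerSeries.coeff r (aglerSeries p) • φ (MvPolynomial.monomial r 1))
        (φ (reflection (multiDegree p) p) * E) :=
  have hs := summable_coeff_smul hρ₀ hρ₁ hφ hC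
  ⟨_, map_mul_evalSeries_inv hp hs, hasSum_coeff_mul_smul hs _⟩

theorem exists_hasSum_aglerSeries_of_mem_polydisk {z : Fin d → ℂ} (hz : z ∈ polydisk d)
    {p : MvPolynomial (Fin d) ℂ} (hp : p.coeff 0 ≠ 0) {C : ℝ}
    (hC : ∀ r, ‖MvPowerSeries.coeff r (p : MvPowerSeries (Fin d) ℂ)⁻¹‖ ≤ C) :
    ∃ E : ℂ, MvPolynomial.eval z p * E = 1 ∧
      HasSum (fun r : Fin d →₀ ℕ => MvPowerSeries.coeff r (aglerSeries p) * ∏ i, z i ^ r i)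
        (MvPolynomial.eval z (reflection (multiDegree p) p) * E) := by
  have hmonomial (r : Fin d →₀ ℕ) :
      MvPolynomial.aeval z (MvPolynomial.monomial r (1 : ℂ)) = ∏ i, z i ^ r i := by
    simp [monomial_eq_C_mul_prod]
  have hsum := exists_hasSum_aglerSeries (φ := MvPolynomial.aeval z) (fun i => norm_nonneg (z i))
    hz (fun r => by simp [hmonomial]) hp hC
  simpa only [hmonomial, smul_eq_mul, MvPolynomial.aeval_eq_eval] using hsum

theorem isAglerDenominator_of_norm_map_reflection_le {p : MvPolynomial (Fin d) ℂ}
    (hp : p.coeff 0 ≠ 0) {C : ℝ}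
    (hC : ∀ r, ‖MvPowerSeries.coeff r (p : MvPowerSeries (Fin d) ℂ)⁻¹‖ ≤ C)
    (hle : ∀ (H : Type u) [NormedAddCommGroup H] [InnerProductSpace ℂ H] [CompleteSpace H]
      (φ : MvPolynomial (Fin d) ℂ →ₐ[ℂ] (H →L[ℂ] H)), (∀ i, ‖φ (MvPolynomial.X i)‖ < 1) →
      ∀ h, ‖φ (reflection (multiDegree p) p) h‖ ≤ ‖φ p h‖) :
    IsAglerDenominator.{u} p := by
  have hstable : IsSemiStable p := fun z hz => by
    obtain ⟨E, hE, -⟩ := exists_hasSum_aglerSeries_of_mem_polydisk hz hp hC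
    exact left_ne_zero_of_mul_eq_one hE
  refine ⟨hstable, ?_, aglerSeries p, fun z hz => ?_, fun H _ _ _ T hcomm hT => ?_⟩
  · exact ((AnalyticOnNhd.eval_mvPolynomial _).mono (Set.subset_univ _)).div
      ((AnalyticOnNhd.eval_mvPolynomial _).mono (Set.subset_univ _)) hstable
  · obtain ⟨E, hE, hsum⟩ := exists_hasSum_aglerSeries_of_mem_polydisk hz hp hC
    rwa [eq_inv_of_mul_eq_one_right hE, ← div_eq_mul_inv] at hsum
  · obtain ⟨φ, hφ⟩ := exists_algHom_X_eq (R := ℂ) T hcomm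
    obtain ⟨E, hE, hsum⟩ := exists_hasSum_aglerSeries (φ := φ) (fun i => norm_nonneg (T i)) hT
      (fun r => by rw [map_monomial_eq_opMonomial hφ]; exact norm_opMonomial_le T r) hp hC
    simp only [map_monomial_eq_opMonomial hφ] at hsum
    refine ⟨_, hsum, ContinuousLinearMap.opNorm_le_bound _ zero_le_one fun h => ?_⟩
    calc ‖(φ (reflection (multiDegree p) p) * E) h‖ ≤ ‖φ p (E h)‖ :=
          hle H φ (fun i => by rw [hφ]; exact hT i) (E h)
      _ = 1 * ‖h‖ := by
          rw [← mul_apply_eq_comp, hE, one_apply_eq_self, one_mul]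

end AglerDenominator

section AffinePolynomial

/-- The affine polynomial `1 - ∑ aᵢ zᵢ`. -/
def affinePoly {σ R : Type*} [Fintype σ] [CommRing R] (a : σ → R) : MvPolynomial σ R :=
  1 - ∑ i, MvPolynomial.C (a i) * MvPolynomial.X i

section Coefficients

variable {σ R : Type*} [Fintype σ] [CommRing R] (a : σ → R)

theorem coeff_zero_affinePoly : (affinePoly a).coeff 0 = 1 := by
  simp [affinePoly, MvPolynomial.coeff_sum]

theorem coeff_single_affinePoly (i : σ) : (affinePoly a).coeff (Finsupp.single i 1) = -a i := by
  classical
  simp [affinePoly, MvPolynomial.coeff_sum, MvPolynomial.coeff_one, MvPolynomial.coeff_C_mul,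
    MvPolynomial.coeff_X, Finsupp.single_left_inj, eq_comm (a := (0 : σ →₀ ℕ))]

theorem degreeOf_affinePoly_le_one (i : σ) : (affinePoly a).degreeOf i ≤ 1 := by
  classical
  rcases subsingleton_or_nontrivial R
  · simp [Subsingleton.elim (affinePoly a) 0]
  refine (MvPolynomial.degreeOf_sub_le i _ _).trans (max_le (by simp) ?_)
  refine (MvPolynomial.degreeOf_sum_le i _ _).trans (Finset.sup_le fun j _ => ?_)
  refine (MvPolynomial.degreeOf_C_mul_le _ i _).trans ?_
  rw [MvPolynomial.degreeOf_X]
  split_ifs <;> simp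

end Coefficients

theorem norm_coeff_affinePoly_inv_le {σ 𝕜 : Type*} [Fintype σ] [NormedField 𝕜] {a : σ → 𝕜}
    (ha : ∑ i, ‖a i‖ ≤ 1) (r : σ →₀ ℕ) :
    ‖MvPowerSeries.coeff r (affinePoly a : MvPowerSeries σ 𝕜)⁻¹‖ ≤ 1 := by
  classical
  set g := (affinePoly a : MvPowerSeries σ 𝕜)⁻¹
  have hmul : (affinePoly a : MvPowerSeries σ 𝕜) * g = 1 :=
    MvPowerSeries.mul_inv_cancel _ (by simp [constantCoeff_coe, coeff_zero_affinePoly])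
  have hg : g = 1 + ∑ i, MvPowerSeries.monomial (Finsupp.single i 1) (a i) * g := by
    have hcoe : (affinePoly a : MvPowerSeries σ 𝕜) =
        1 - ∑ i, MvPowerSeries.monomial (Finsupp.single i 1) (a i) := by
      simp only [affinePoly, ← MvPolynomial.coeToMvPowerSeries.ringHom_apply, map_sub, map_one,
        map_sum, MvPolynomial.C_mul_X_eq_monomial]
      simp only [MvPolynomial.coeToMvPowerSeries.ringHom_apply, MvPolynomial.coe_monomial]
    rwa [hcoe, sub_mul, one_mul, Finset.sum_mul, sub_eq_iff_eq_add] at hmul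
  induction r using WellFoundedLT.induction with
  | ind r ih =>
    rcases eq_or_ne r 0 with rfl | hr
    · simp [g, constantCoeff_coe, coeff_zero_affinePoly]
    rw [hg, map_add, map_sum, MvPowerSeries.coeff_one, if_neg hr, zero_add]
    refine (norm_sum_le _ _).trans ((Finset.sum_le_sum fun i _ => ?_).trans ha)
    rw [MvPowerSeries.coeff_monomial_mul]
    split_ifs with hi
    · rw [norm_mul]
      refine mul_le_of_le_one_right (norm_nonneg _) (ih _ ?_)
      calc r - Finsupp.single i 1 < r - Finsupp.single i 1 + Finsupp.single i 1 :=
            lt_add_of_pos_right _ (pos_of_ne_zero (by simp))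
        _ = r := tsub_add_cancel_of_le hi
    · simp

theorem multiDegree_affinePoly {d : ℕ} {a : Fin d → ℂ} {i : Fin d} (hi : a i ≠ 0) :
    multiDegree (affinePoly a) i = 1 := by
  refine le_antisymm (degreeOf_affinePoly_le_one a i) ?_
  have := MvPolynomial.monomial_le_degreeOf i (f := affinePoly a) (m := Finsupp.single i 1)
    (by simpa [MvPolynomial.mem_support_iff, coeff_single_affinePoly] using hi)
  simpa [multiDegree] using this

theorem reflection_eq_sum {d : ℕ} (n : Fin d →₀ ℕ) (p : MvPolynomial (Fin d) ℂ) :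
    reflection n p =
      (AddMonoidAlgebra.coeff p).sum fun k c => MvPolynomial.monomial (n - k) (conj c) := by
  rw [reflection, MvPolynomial.sum_def]

/-- The reflection `p ↦ z^n p̄(1/z)` as an additive map. -/
def reflectionHom {d : ℕ} (n : Fin d →₀ ℕ) :
    MvPolynomial (Fin d) ℂ →+ MvPolynomial (Fin d) ℂ :=
  AddMonoidHom.mk' (reflection n) fun p q => by
    simp only [reflection_eq_sum]
    exact Finsupp.sum_add_index' (by simp) (by simp)

theorem reflectionHom_monomial {d : ℕ} (n k : Fin d →₀ ℕ) (c : ℂ) :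
    reflectionHom n (MvPolynomial.monomial k c) = MvPolynomial.monomial (n - k) (conj c) :=
  (reflection_eq_sum _ _).trans (Finsupp.sum_single_index (by simp))

theorem reflection_affinePoly {d : ℕ} (n : Fin d →₀ ℕ) (a : Fin d → ℂ) :
    reflection n (affinePoly a) = MvPolynomial.monomial n 1 -
      ∑ i, MvPolynomial.monomial (n - Finsupp.single i 1) (conj (a i)) := by
  change reflectionHom n (affinePoly a) = _
  simp only [affinePoly, MvPolynomial.one_def, MvPolynomial.C_mul_X_eq_monomial, map_sub, map_sum,
    reflectionHom_monomial, map_one, tsub_zero]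

theorem affinePoly_eq_one_sub_sum_X_pow_multiDegree {d : ℕ} (a : Fin d → ℂ) :
    affinePoly a = 1 - ∑ i, MvPolynomial.C (a i) *
      MvPolynomial.X i ^ multiDegree (affinePoly a) i := by
  rw [affinePoly]
  congr! 2 with i
  rcases eq_or_ne (a i) 0 with hi | hi
  · simp [hi]
  · rw [← affinePoly, multiDegree_affinePoly hi, pow_one]

theorem reflection_multiDegree_affinePoly {d : ℕ} (a : Fin d → ℂ) :
    reflection (multiDegree (affinePoly a)) (affinePoly a) =
      ∏ i, MvPolynomial.X i ^ multiDegree (affinePoly a) i -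
        ∑ i, MvPolynomial.C (conj (a i)) *
          ∏ j ∈ Finset.univ.erase i, MvPolynomial.X j ^ multiDegree (affinePoly a) j := by
  rw [reflection_affinePoly, monomial_eq_C_mul_prod, map_one, one_mul]
  congr! 2 with i
  rcases eq_or_ne (a i) 0 with hi | hi
  · simp [hi]
  rw [monomial_eq_C_mul_prod, ← Finset.mul_prod_erase _ _ (Finset.mem_univ i)]
  have hpow : (multiDegree (affinePoly a) - Finsupp.single i 1 : Fin d →₀ ℕ) i = 0 := by
    simp [multiDegree_affinePoly hi]
  rw [hpow, pow_zero, one_mul]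
  congr 1
  refine Finset.prod_congr rfl fun j hj => ?_
  simp [Finsupp.single_eq_of_ne (Finset.ne_of_mem_erase hj)]

theorem norm_map_reflection_affinePoly_le {d : ℕ} {H : Type*} [NormedAddCommGroup H]
    [InnerProductSpace ℂ H] {φ : MvPolynomial (Fin d) ℂ →ₐ[ℂ] (H →L[ℂ] H)}
    (hφ : ∀ i, ‖φ (MvPolynomial.X i)‖ ≤ 1) {a : Fin d → ℂ} (ha : ∑ i, ‖a i‖ ≤ 1) (h : H) :
    ‖φ (reflection (multiDegree (affinePoly a)) (affinePoly a)) h‖ ≤ ‖φ (affinePoly a) h‖ := by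
  let _ : Module (MvPolynomial (Fin d) ℂ) H := Module.compHom H φ.toRingHom
  have hsmul (P : MvPolynomial (Fin d) ℂ) (x : H) : P • x = φ P x := rfl
  have : IsScalarTower ℂ (MvPolynomial (Fin d) ℂ) H :=
    ⟨fun c P x => by rw [hsmul, hsmul, map_smul, _root_.smul_apply]⟩
  have hX (i : Fin d) (k : ℕ) (x : H) :
      ‖(MvPolynomial.X i : MvPolynomial (Fin d) ℂ) ^ k • x‖ ≤ ‖x‖ := by
    induction k with
    | zero => simp
    | succ k ih =>
      rw [pow_succ', mul_smul, hsmul (MvPolynomial.X i)]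
      exact ((φ (MvPolynomial.X i)).le_of_opNorm_le (hφ i) _).trans (by rwa [one_mul])
  have hdom := norm_prod_sub_sum_smul_le ha (fun i => hX i (multiDegree (affinePoly a) i)) h
  rwa [MvPolynomial.algebraMap_eq, ← reflection_multiDegree_affinePoly,
    ← affinePoly_eq_one_sub_sum_X_pow_multiDegree] at hdom

end AffinePolynomial

end AglerDen

end

theorem mainTheorem4 (d : ℕ) (a : Fin d → ℂ) (ha : ∑ i, ‖a i‖ ≤ 1) :
    AglerDen.IsAglerDenominator.{u}
      (1 - ∑ i, MvPolynomial.C (a i) * MvPolynomial.X i : MvPolynomial (Fin d) ℂ) := by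
  have hcoeff : (AglerDen.affinePoly a).coeff 0 ≠ 0 := by
    rw [AglerDen.coeff_zero_affinePoly]
    exact one_ne_zero
  exact AglerDen.isAglerDenominator_of_norm_map_reflection_le hcoeff
    (AglerDen.norm_coeff_affinePoly_inv_le ha)
    fun _ _ _ _ _ hφ => AglerDen.norm_map_reflection_affinePoly_le (fun i => (hφ i).le) ha
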